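/- **Theorem** ("The collection of closed subspaces of the algebra of trace class operators is a unitless Girard quantale"). Let $H$ be an infinite-dimensional (real or complex) Hilbert space with orthonormal basis $\mathcal E$. A bounded linear operator $f:H\to H$ is *trace class* if $\sum_{e\in\mathcal E}\langle |f|e,e\rangle<\infty$, where $|f|$ is the positive operator with $|f|^2=f^*f$; for such $f$ put $\operatorname{tr}(f)=\sum_{e\in\mathcal E}\langle f(e),e\rangle$. Let $\mathcal T$ be the set of trace class operators. For $X\subseteq\mathcal T$ let $X^{\perp}=\{g\in\mathcal T : \operatorname{tr}(fg)=0 \text{ for all } f\in X\}$, and call $X$ *closed* if $X^{\perp\perp}=X$. A *quantale* is a complete lattice $Q$ with an associative multiplication $*$ that distributes over arbitrary suprema in each argument; put $x\backslash z=\bigvee\{y : x*y\le z\}$ and $z/y=\bigvee\{x : x*y\le z\}$. A *Girard quantale* is a quantale together with an antitone map $(-)^{\perp}:Q\to Q$ such that $x^{\perp\perp}=x$ and $x\backslash y^{\perp}=x^{\perp}/y$ for all $x,y\in Q$; it is not required to have a unit. Then: 1. $\mathcal T$ is a $*$-subalgebra (not assumed unital) of the algebra of bounded operators on $H$, the series defining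 $\operatorname{tr}(f)$ converges for every $f\in\mathcal T$, and the algebra $\mathcal T$ has no unit. 2. Every closed subset of $\mathcal T$ is a linear subspace. 3. The closed subsets of $\mathcal T$, ordered by inclusion, with multiplication $X*Y=\{fg : f\in X,\ g\in Y\}^{\perp\perp}$ and negation $X\mapsto X^{\perp}$, form a Girard quantale. 4. This quantale has no unit: there is no closed $U$ with $U*X=X=X*U$ for all closed $X$. -/

import Mathlib

open scoped Quantale Pointwise

/-- A Frobenius quantale structure on a (possibly non-unital) quantale `Q`: inverse antitone maps
`lneg`, `rneg` (left and right negation) with `x \ lneg y = rneg x / y` for all `x`, `y`.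
Here `x ⇨ᵣ z` is `x \ z = ⋁ {y | x * y ≤ z}` and `y ⇨ₗ z` is `z / y = ⋁ {x | x * y ≤ z}`. -/
structure IsFrobeniusQuantale {Q : Type*} [Semigroup Q] [CompleteLattice Q] [IsQuantale Q]
    (lneg rneg : Q → Q) : Prop where
  antitone_lneg : Antitone lneg
  antitone_rneg : Antitone rneg
  leftInverse : Function.LeftInverse lneg rneg
  rightInverse : Function.RightInverse lneg rneg
  contraposition : ∀ x y : Q, (x ⇨ᵣ lneg y) = (y ⇨ₗ rneg x)

/-- A Girard quantale is a Frobenius quantale whose left and right negations coincide. -/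
def IsGirardQuantale {Q : Type*} [Semigroup Q] [CompleteLattice Q] [IsQuantale Q]
    (neg : Q → Q) : Prop :=
  IsFrobeniusQuantale neg neg

namespace TraceClass

variable {𝕜 : Type*} [RCLike 𝕜] {H : Type*} [NormedAddCommGroup H] [InnerProductSpace 𝕜 H]
  [CompleteSpace H] {ι : Type*}

/-- A bounded operator `f` is trace class if `∑ ⟨|f| e, e⟩ < ∞`, where `e` runs over the
orthonormal basis `b` and `|f|` is the positive operator with `|f|² = f* f`. -/
def IsTraceClass (b : HilbertBasis ι 𝕜 H) (f : H →L[𝕜] H) : Prop :=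
  ∃ p : H →L[𝕜] H, p.IsPositive ∧ p * p = star f * f ∧
    Summable fun i => RCLike.re (inner 𝕜 (p (b i)) (b i))

/-- The trace `tr f = ∑ ⟨f e, e⟩`. Mathlib's inner product is linear in its second argument, so
the summand, linear in `f`, is written `inner 𝕜 e (f e)`. -/
noncomputable def trace (b : HilbertBasis ι 𝕜 H) (f : H →L[𝕜] H) : 𝕜 :=
  ∑' i, inner 𝕜 (b i) (f (b i))

/-- The orthogonal of `X` in the algebra of trace class operators, for the pairing `tr (f g)`. -/
def orth (b : HilbertBasis ι 𝕜 H) (X : Set (H →L[𝕜] H)) : Set (H →L[𝕜] H) :=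
  {g | IsTraceClass b g ∧ ∀ f ∈ X, trace b (f * g) = 0}

/-- The closed subspaces of the algebra of trace class operators: the sets `X` of trace class
operators with `Xᗮᗮ = X`. -/
structure ClosedSubspace (b : HilbertBasis ι 𝕜 H) where
  carrier : Set (H →L[𝕜] H)
  isTraceClass : ∀ f ∈ carrier, IsTraceClass b f
  orth_orth : orth b (orth b carrier) = carrier

end TraceClass

/-! Everything rests on two facts: the trace class operators form a two-sided ideal, and `tr (f g) =
tr (g f)` on it.

Analysis. A positive operator has a positive square root, given by a power series that works over
both scalar fields. With Douglas factorization it gives `f = u |f|` and `|f| = v f`. Hence `f` is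
trace class iff it is a product of two Hilbert–Schmidt operators (`isTraceClass_iff`). This yields
the ideal property, and cyclicity is an exchange of summations.

Algebra. By cyclicity `X ↦ Xᗮ` is a Galois connection with itself, and `X * Y ≤ Zᗮ` says that `tr (x
y z) = 0` throughout, a condition invariant under rotating `X, Y, Z` (`mul_le_neg_rotate`).
Residuals, distributivity, associativity and the Girard law follow formally.

No unit. Testing a unit `U` on rank one projections makes every vector an eigenvector of each `u ∈
U`. So `u` is a scalar, and in infinite dimension only the scalar `0` is trace class. Then `U = 0`,
which is absurd. -/

/-! ### Catalan series and the square root of `1 - 4x` -/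

section CatalanSeries

open Finset

/-- The antidiagonals below `N` are disjoint subsets of the square `range N × range N`. -/
theorem sum_range_sum_antidiagonal_mul_le_sq {a : ℕ → ℝ} (ha : ∀ n, 0 ≤ a n) (N : ℕ) :
    ∑ n ∈ range N, ∑ p ∈ antidiagonal n, a p.1 * a p.2 ≤ (∑ n ∈ range N, a n) ^ 2 := by
  rw [sq, sum_mul_sum, ← sum_product', ← sum_biUnion]
  · refine sum_le_sum_of_subset_of_nonneg ?_ fun p _ _ => mul_nonneg (ha _) (ha _)
    rintro ⟨i, j⟩ h
    simp only [mem_biUnion, mem_range, HasAntidiagonal.mem_antidiagonal, mem_product] at h ⊢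
    obtain ⟨n, hn, h⟩ := h
    omega
  · intro m _ n _ hmn
    rw [Function.onFun, disjoint_left]
    intro p hp hq
    rw [HasAntidiagonal.mem_antidiagonal] at hp hq
    exact hmn (hp.symm.trans hq)

/-- The Catalan recursion gives `S (N + 1) ≤ 1 + (S N)² / 4` for the partial sums, and this
preserves `0 ≤ S ≤ 2`. The series is thus controlled on the boundary of its disc of convergence,
where it is needed. -/
theorem sum_range_catalan_div_four_pow_le (N : ℕ) :
    ∑ n ∈ range N, (catalan n : ℝ) * (1 / 4) ^ n ≤ 2 := by
  induction N with
  | zero => simp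
  | succ N ih =>
    rw [sum_range_succ']
    have h0 : 0 ≤ ∑ n ∈ range N, (catalan n : ℝ) * (1 / 4) ^ n :=
      sum_nonneg fun n _ => by positivity
    have h : ∑ n ∈ range N, (catalan (n + 1) : ℝ) * (1 / 4) ^ (n + 1) =
        1 / 4 * ∑ n ∈ range N, ∑ p ∈ antidiagonal n,
          ((catalan p.1 : ℝ) * (1 / 4) ^ p.1) * ((catalan p.2 : ℝ) * (1 / 4) ^ p.2) := by
      rw [mul_sum]
      refine sum_congr rfl fun n _ => ?_
      rw [catalan_succ', Nat.cast_sum, sum_mul, mul_sum]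
      refine sum_congr rfl fun p hp => ?_
      rw [← HasAntidiagonal.mem_antidiagonal.1 hp, Nat.cast_mul]
      ring
    have h1 := sum_range_sum_antidiagonal_mul_le_sq
      (a := fun n => (catalan n : ℝ) * (1 / 4) ^ n) (fun n => by positivity) N
    rw [h]
    simp only [catalan_zero, Nat.cast_one, pow_zero, mul_one]
    nlinarith

theorem summable_catalan_div_four_pow : Summable fun n => (catalan n : ℝ) * (1 / 4) ^ n :=
  summable_of_sum_range_le (fun n => by positivity) sum_range_catalan_div_four_pow_le

variable (𝕜 : Type*) [RCLike 𝕜] {R : Type*} [NormedRing R] [NormOneClass R] [NormedAlgebra 𝕜 R]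

/-- The generating series of the Catalan numbers. -/
noncomputable def catalanSeries (x : R) : R :=
  ∑' n, (catalan n : 𝕜) • x ^ n

theorem norm_catalan_smul_pow_le {x : R} (hx : ‖x‖ ≤ 1 / 4) (n : ℕ) :
    ‖(catalan n : 𝕜) • x ^ n‖ ≤ (catalan n : ℝ) * (1 / 4) ^ n := by
  rw [norm_smul, RCLike.norm_natCast]
  gcongr
  exact (norm_pow_le x n).trans (by gcongr)

theorem summable_norm_catalan_smul_pow {x : R} (hx : ‖x‖ ≤ 1 / 4) :
    Summable fun n => ‖(catalan n : 𝕜) • x ^ n‖ :=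
  .of_nonneg_of_le (fun _ => norm_nonneg _) (norm_catalan_smul_pow_le 𝕜 hx)
    summable_catalan_div_four_pow

theorem norm_catalanSeries_le {x : R} (hx : ‖x‖ ≤ 1 / 4) : ‖catalanSeries 𝕜 x‖ ≤ 2 :=
  (tsum_of_norm_bounded summable_catalan_div_four_pow.hasSum (norm_catalan_smul_pow_le 𝕜 hx)).trans
    (Real.tsum_le_of_sum_range_le (fun n => by positivity) sum_range_catalan_div_four_pow_le)

variable [CompleteSpace R]

theorem commute_catalanSeries {x : R} (hx : ‖x‖ ≤ 1 / 4) : Commute x (catalanSeries 𝕜 x) := by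
  have h := (summable_norm_catalan_smul_pow 𝕜 hx).of_norm
  rw [commute_iff_eq, catalanSeries, ← h.tsum_mul_left, ← h.tsum_mul_right]
  refine tsum_congr fun n => ?_
  rw [mul_smul_comm, smul_mul_assoc, ← pow_succ, ← pow_succ']

/-- The Catalan recursion, read through the Cauchy product: `C = 1 + x C²`. -/
theorem mul_catalanSeries_sq {x : R} (hx : ‖x‖ ≤ 1 / 4) :
    x * (catalanSeries 𝕜 x * catalanSeries 𝕜 x) = catalanSeries 𝕜 x - 1 := by
  have hs := summable_norm_catalan_smul_pow 𝕜 hx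
  have h : catalanSeries 𝕜 x * catalanSeries 𝕜 x = ∑' n, (catalan (n + 1) : 𝕜) • x ^ n := by
    rw [catalanSeries, tsum_mul_tsum_eq_tsum_sum_antidiagonal_of_summable_norm hs hs]
    refine tsum_congr fun n => ?_
    rw [catalan_succ', Nat.cast_sum, sum_smul]
    refine sum_congr rfl fun p hp => ?_
    rw [smul_mul_smul_comm, ← pow_add, HasAntidiagonal.mem_antidiagonal.1 hp, Nat.cast_mul]
  have h1 : Summable fun n => (catalan (n + 1) : 𝕜) • x ^ n := by
    have := (summable_norm_sum_mul_antidiagonal_of_summable_norm hs hs).of_norm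
    refine this.congr fun n => ?_
    rw [catalan_succ', Nat.cast_sum, sum_smul]
    refine sum_congr rfl fun p hp => ?_
    rw [smul_mul_smul_comm, ← pow_add, HasAntidiagonal.mem_antidiagonal.1 hp, Nat.cast_mul]
  rw [h, ← h1.tsum_mul_left, eq_sub_iff_add_eq', catalanSeries, hs.of_norm.tsum_eq_zero_add]
  simp [pow_succ', catalan_zero]

/-- The square root of `1 - 4 x`, as a power series. -/
noncomputable def sqrtOneSubFourMul (x : R) : R :=
  1 - (2 : 𝕜) • (x * catalanSeries 𝕜 x)

theorem sqrtOneSubFourMul_mul_self {x : R} (hx : ‖x‖ ≤ 1 / 4) :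
    sqrtOneSubFourMul 𝕜 x * sqrtOneSubFourMul 𝕜 x = 1 - (4 : 𝕜) • x := by
  have h1 : x * catalanSeries 𝕜 x * (x * catalanSeries 𝕜 x) = x * catalanSeries 𝕜 x - x := by
    calc x * catalanSeries 𝕜 x * (x * catalanSeries 𝕜 x)
        = x * (catalanSeries 𝕜 x * x * catalanSeries 𝕜 x) := by noncomm_ring
      _ = x * (x * (catalanSeries 𝕜 x * catalanSeries 𝕜 x)) := by
          rw [← (commute_catalanSeries 𝕜 hx).eq, mul_assoc]
      _ = _ := by rw [mul_catalanSeries_sq 𝕜 hx]; noncomm_ring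
  rw [sqrtOneSubFourMul, sub_mul, mul_sub, mul_sub, one_mul, one_mul, mul_one,
    smul_mul_smul_comm, h1]
  module

theorem isSelfAdjoint_sqrtOneSubFourMul [StarRing R] [StarModule 𝕜 R] [ContinuousStar R] {x : R}
    (hx : ‖x‖ ≤ 1 / 4) (hs : IsSelfAdjoint x) : IsSelfAdjoint (sqrtOneSubFourMul 𝕜 x) := by
  have h : IsSelfAdjoint (catalanSeries 𝕜 x) := by
    rw [IsSelfAdjoint, catalanSeries, tsum_star]
    refine tsum_congr fun n => ?_
    rw [star_smul, star_pow, hs.star_eq, star_natCast]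
  rw [IsSelfAdjoint, sqrtOneSubFourMul, star_sub, star_one, star_smul, star_mul, h.star_eq,
    hs.star_eq, star_ofNat, (commute_catalanSeries 𝕜 hx).eq]

end CatalanSeries

/-! ### Positive square roots and Douglas factorization -/

namespace ContinuousLinearMap

variable {𝕜 : Type*} [RCLike 𝕜] {H : Type*} [NormedAddCommGroup H] [InnerProductSpace 𝕜 H]
  [CompleteSpace H]

theorem isPositive_one_sub_of_norm_le_one {t : H →L[𝕜] H} (ht : IsSelfAdjoint t)
    (h : ‖t‖ ≤ 1) : (1 - t).IsPositive := by
  refine isPositive_def'.2 ⟨(IsSelfAdjoint.one _).sub ht, fun x => ?_⟩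
  have h1 : RCLike.re (inner 𝕜 (t x) x) ≤ ‖x‖ * ‖x‖ :=
    (re_inner_le_norm _ _).trans (by gcongr; simpa using t.le_of_opNorm_le h x)
  simp only [reApplyInnerSelf, sub_apply, one_apply_eq_self, inner_sub_left, map_sub,
    inner_self_eq_norm_mul_norm]
  linarith

/-- The norm of a self-adjoint operator is the supremum of its absolute Rayleigh quotients; those of
`a` lie in `[0, 1]`. -/
theorem IsPositive.norm_one_sub_le {a : H →L[𝕜] H} (ha : a.IsPositive) (h : ‖a‖ ≤ 1) :
    ‖1 - a‖ ≤ 1 := by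
  have hsa : IsSelfAdjoint (1 - a) := (IsSelfAdjoint.one _).sub ha.isSelfAdjoint
  rw [norm_eq_iSup_rayleighQuotient _ hsa.isSymmetric]
  refine ciSup_le fun x => ?_
  by_cases hx : x = 0
  · simp [hx]
  have hx' : 0 < ‖x‖ ^ 2 := by positivity
  have h0 := ha.re_inner_nonneg_left x
  have h1 : RCLike.re (inner 𝕜 (a x) x) ≤ ‖x‖ ^ 2 := by
    rw [sq]
    exact (re_inner_le_norm _ _).trans (by gcongr; simpa using a.le_of_opNorm_le h x)
  rw [rayleighQuotient, abs_div, abs_of_pos hx', div_le_one hx', abs_le]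
  simp only [reApplyInnerSelf, sub_apply, one_apply_eq_self, inner_sub_left, map_sub,
    inner_self_eq_norm_sq]
  constructor <;> linarith

theorem IsPositive.exists_sqrt {a : H →L[𝕜] H} (ha : a.IsPositive) :
    ∃ s : H →L[𝕜] H, s.IsPositive ∧ s * s = a := by
  rcases eq_or_ne a 0 with rfl | h0
  · exact ⟨0, isPositive_zero, mul_zero _⟩
  have : Nontrivial H := by
    by_contra hH
    rw [not_nontrivial_iff_subsingleton] at hH
    exact h0 (ext fun x => Subsingleton.elim _ _)
  have hn : 0 < ‖a‖ := norm_pos_iff.2 h0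
  set c : H →L[𝕜] H := ((‖a‖⁻¹ : ℝ) : 𝕜) • a with hc
  have hcp : c.IsPositive := by
    exact ha.smul_of_nonneg (by exact_mod_cast (inv_nonneg.2 hn.le))
  have hcn : ‖c‖ ≤ 1 := by
    rw [hc, norm_smul, RCLike.norm_ofReal, abs_inv, abs_norm, inv_mul_cancel₀ hn.ne']
  -- Chosen so that `1 - 4x = c`.
  set x : H →L[𝕜] H := (1 / 4 : 𝕜) • (1 - c) with hx
  have hxn : ‖x‖ ≤ 1 / 4 := by
    have := hcp.norm_one_sub_le hcn
    rw [hx, norm_smul, norm_div, norm_one, RCLike.norm_ofNat]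
    linarith
  have hxs : IsSelfAdjoint x := by
    have : IsSelfAdjoint (1 - c) := (IsSelfAdjoint.one _).sub hcp.isSelfAdjoint
    rw [IsSelfAdjoint, hx, star_smul, this.star_eq]
    simp
  -- The root is `1 - 2xC(x)` with `‖2xC(x)‖ ≤ 2 · (1/4) · 2 = 1`, hence positive.
  have hs : (sqrtOneSubFourMul 𝕜 x).IsPositive := by
    refine isPositive_one_sub_of_norm_le_one ?_ ?_
    · simpa [sqrtOneSubFourMul] using
        (IsSelfAdjoint.one (H →L[𝕜] H)).sub (isSelfAdjoint_sqrtOneSubFourMul 𝕜 hxn hxs)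
    · rw [norm_smul, RCLike.norm_ofNat]
      have := (norm_mul_le x (catalanSeries 𝕜 x)).trans
        (mul_le_mul hxn (norm_catalanSeries_le 𝕜 hxn) (norm_nonneg _) (by norm_num))
      linarith
  refine ⟨((Real.sqrt ‖a‖ : ℝ) : 𝕜) • sqrtOneSubFourMul 𝕜 x, ?_, ?_⟩
  · exact hs.smul_of_nonneg (by exact_mod_cast (Real.sqrt_nonneg _))
  · rw [smul_mul_smul_comm, ← RCLike.ofReal_mul, Real.mul_self_sqrt hn.le,
      sqrtOneSubFourMul_mul_self 𝕜 hxn, hx,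
      smul_smul, show (4 : 𝕜) * (1 / 4) = 1 by norm_num, one_smul, sub_sub_cancel, hc, smul_smul,
      ← RCLike.ofReal_mul, mul_inv_cancel₀ hn.ne', RCLike.ofReal_one,
      one_smul]

/-- Douglas' factorization lemma. -/
theorem exists_eq_mul_of_norm_apply_le {f g : H →L[𝕜] H} (h : ∀ x, ‖f x‖ ≤ ‖g x‖) :
    ∃ u : H →L[𝕜] H, f = u * g := by
  let K : Submodule 𝕜 H := (LinearMap.range (g : H →ₗ[𝕜] H)).topologicalClosure
  have hK : ∀ x, g x ∈ K := fun x =>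
    Submodule.le_topologicalClosure _ (LinearMap.mem_range_self (g : H →ₗ[𝕜] H) x)
  have : CompleteSpace K := (Submodule.isClosed_topologicalClosure _).completeSpace_coe
  let e : H →ₗ[𝕜] K := (g : H →ₗ[𝕜] H).codRestrict K hK
  have he : DenseRange e := by
    rintro ⟨y, hy⟩
    rw [closure_subtype]
    have : ((↑) '' Set.range e : Set H) = LinearMap.range (g : H →ₗ[𝕜] H) := by
      ext z
      simp [e]
    rw [this]
    exact hy
  -- The map `g x ↦ f x` is contractive on the range of `g`; it extends to the closure `K`, and
  -- projecting onto `K` first defines it on `H`.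
  refine ⟨((f : H →ₗ[𝕜] H).extendOfNorm e).comp K.orthogonalProjectionOnto, ?_⟩
  ext x
  have h1 : K.orthogonalProjectionOnto (g x) = e x :=
    Submodule.orthogonalProjectionOnto_mem_subspace_eq_self (K := K) (e x)
  have h2 := LinearMap.extendOfNorm_eq (f := (f : H →ₗ[𝕜] H)) he
    ⟨1, fun x => by simpa [e] using h x⟩ x
  change f x = (f : H →ₗ[𝕜] H).extendOfNorm e (K.orthogonalProjectionOnto (g x))
  rw [h1, h2]
  rfl

end ContinuousLinearMap

/-! ### Hilbert–Schmidt and trace class operators -/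

namespace TraceClass

variable {𝕜 : Type*} [RCLike 𝕜] {H : Type*} [NormedAddCommGroup H] [InnerProductSpace 𝕜 H]
  [CompleteSpace H] {ι : Type*} (b : HilbertBasis ι 𝕜 H)

open ContinuousLinearMap InnerProductSpace

/-- Hilbert–Schmidt operators: the matrix entries in the orthonormal basis are square summable. -/
def IsHilbertSchmidt (f : H →L[𝕜] H) : Prop :=
  Summable fun p : ι × ι => ‖inner 𝕜 (b p.1) (f (b p.2))‖ ^ 2

variable {b}

omit [CompleteSpace H] in
theorem hasSum_norm_inner_sq (b : HilbertBasis ι 𝕜 H) (x : H) :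
    HasSum (fun i => ‖inner 𝕜 (b i) x‖ ^ 2) (‖x‖ ^ 2) := by
  have h := (RCLike.hasSum_re 𝕜 (b.hasSum_inner_mul_inner x x))
  rw [inner_self_eq_norm_sq] at h
  refine h.congr_fun fun i => ?_
  rw [inner_mul_symm_re_eq_norm, norm_mul, ← norm_inner_symm x (b i), sq, norm_inner_symm]

omit [CompleteSpace H] in
theorem isHilbertSchmidt_iff {f : H →L[𝕜] H} :
    IsHilbertSchmidt b f ↔ Summable fun i => ‖f (b i)‖ ^ 2 := by
  rw [IsHilbertSchmidt, ← (Equiv.prodComm ι ι).summable_iff,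
    summable_prod_of_nonneg fun p => by
      simp only [Function.comp_apply, Pi.zero_apply]; positivity]
  simp only [Function.comp_def, Equiv.prodComm_apply, Prod.fst_swap, Prod.snd_swap,
    (hasSum_norm_inner_sq b _).tsum_eq]
  exact and_iff_right fun i => (hasSum_norm_inner_sq b _).summable

namespace IsHilbertSchmidt

variable {f g : H →L[𝕜] H}

theorem star (hf : IsHilbertSchmidt b f) : IsHilbertSchmidt b (star f) := by
  rw [IsHilbertSchmidt, ← (Equiv.prodComm ι ι).summable_iff]
  refine hf.congr fun p => ?_
  simp only [Function.comp_apply, Equiv.prodComm_apply, Prod.fst_swap, Prod.snd_swap,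
    star_eq_adjoint, adjoint_inner_right]
  rw [norm_inner_symm]

omit [CompleteSpace H] in
theorem mul_left (hf : IsHilbertSchmidt b f) (u : H →L[𝕜] H) : IsHilbertSchmidt b (u * f) := by
  rw [isHilbertSchmidt_iff] at hf ⊢
  refine .of_nonneg_of_le (fun _ => sq_nonneg _) (fun i => ?_) (hf.mul_left (‖u‖ ^ 2))
  rw [← mul_pow]
  gcongr
  exact u.le_opNorm _

theorem mul_right (hf : IsHilbertSchmidt b f) (u : H →L[𝕜] H) : IsHilbertSchmidt b (f * u) := by
  have := (hf.star.mul_left (Star.star u)).star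
  rwa [← star_mul, star_star] at this

theorem summable_inner (hf : IsHilbertSchmidt b f) (hg : IsHilbertSchmidt b g) :
    Summable fun i => inner 𝕜 (b i) ((f * g) (b i)) := by
  have hf' := isHilbertSchmidt_iff.1 hf.star
  have hg' := isHilbertSchmidt_iff.1 hg
  refine .of_norm_bounded (hf'.add hg') fun i => ?_
  have : inner 𝕜 (b i) ((f * g) (b i)) = inner 𝕜 (Star.star f (b i)) (g (b i)) := by
    rw [star_eq_adjoint, adjoint_inner_left]; rfl
  rw [this]
  have := norm_inner_le_norm (𝕜 := 𝕜) (Star.star f (b i)) (g (b i))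
  nlinarith [sq_nonneg (‖Star.star f (b i)‖ - ‖g (b i)‖), sq_nonneg ‖Star.star f (b i)‖,
    sq_nonneg ‖g (b i)‖]

theorem trace_mul_eq_tsum (f g : H →L[𝕜] H) : trace b (f * g) =
    ∑' i, ∑' j, inner 𝕜 (b i) (f (b j)) * inner 𝕜 (b j) (g (b i)) := by
  refine tsum_congr fun i => ?_
  have : inner 𝕜 (b i) ((f * g) (b i)) = inner 𝕜 (Star.star f (b i)) (g (b i)) := by
    rw [star_eq_adjoint, adjoint_inner_left]; rfl
  rw [this, ← b.tsum_inner_mul_inner]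
  refine tsum_congr fun j => ?_
  rw [star_eq_adjoint, adjoint_inner_left]

/-- Both traces are iterated sums of one double series, absolutely summable because `s t ≤ s² + t²`.
-/
theorem trace_mul_comm (hf : IsHilbertSchmidt b f) (hg : IsHilbertSchmidt b g) :
    trace b (f * g) = trace b (g * f) := by
  have h : Summable fun p : ι × ι =>
      inner 𝕜 (b p.1) (f (b p.2)) * inner 𝕜 (b p.2) (g (b p.1)) := by
    have hg' : Summable fun p : ι × ι => ‖inner 𝕜 (b p.2) (g (b p.1))‖ ^ 2 :=
      (Equiv.prodComm ι ι).summable_iff.2 hg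
    refine .of_norm_bounded (hf.add hg') fun p => ?_
    rw [norm_mul]
    generalize ‖inner 𝕜 (b p.1) (f (b p.2))‖ = s, ‖inner 𝕜 (b p.2) (g (b p.1))‖ = t
    nlinarith [sq_nonneg (s - t), sq_nonneg s, sq_nonneg t]
  rw [trace_mul_eq_tsum, trace_mul_eq_tsum]
  refine (Summable.tsum_comm (f := fun i j =>
    inner 𝕜 (b i) (f (b j)) * inner 𝕜 (b j) (g (b i))) h).symm.trans ?_
  exact tsum_congr fun i => tsum_congr fun j => mul_comm _ _

omit [CompleteSpace H] in
theorem rankOne (x y : H) : IsHilbertSchmidt b (rankOne 𝕜 x y) := by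
  rw [isHilbertSchmidt_iff]
  refine ((hasSum_norm_inner_sq b y).summable.mul_right (‖x‖ ^ 2)).congr fun i => ?_
  rw [rankOne_apply, norm_smul, mul_pow, norm_inner_symm]

omit [CompleteSpace H] in
theorem zero : IsHilbertSchmidt b (0 : H →L[𝕜] H) := by
  simp [isHilbertSchmidt_iff, summable_zero]

end IsHilbertSchmidt

theorem norm_apply_eq_of_mul_self_eq {p f : H →L[𝕜] H} (hp : p.IsPositive)
    (h : p * p = star f * f) (x : H) : ‖f x‖ = ‖p x‖ := by
  have h1 : inner 𝕜 (p (p x)) x = inner 𝕜 (adjoint f (f x)) x :=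
    congrArg (fun g : H →L[𝕜] H => inner 𝕜 (g x) x) h
  rw [adjoint_inner_left, hp.inner_left_eq_inner_right, inner_self_eq_norm_sq_to_K,
    inner_self_eq_norm_sq_to_K] at h1
  have h2 : ‖p x‖ ^ 2 = ‖f x‖ ^ 2 := by exact_mod_cast h1
  exact ((pow_left_inj₀ (norm_nonneg _) (norm_nonneg _) two_ne_zero).1 h2).symm

/-- Only the `v` with `v f = |f|` is used. Unlike the definition, the hypothesis is visibly additive
in `f`, which gives closure under sums. -/
theorem isTraceClass_of_summable_inner {f : H →L[𝕜] H}
    (h : ∀ v : H →L[𝕜] H, Summable fun i => inner 𝕜 (b i) ((v * f) (b i))) :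
    IsTraceClass b f := by
  obtain ⟨p, hp, hpf⟩ := (isPositive_adjoint_comp_self f).exists_sqrt
  obtain ⟨v, hv⟩ := exists_eq_mul_of_norm_apply_le fun x =>
    (norm_apply_eq_of_mul_self_eq hp hpf x).ge
  refine ⟨p, hp, hpf, ?_⟩
  refine (RCLike.hasSum_re 𝕜 (h v).hasSum).summable.congr fun i => ?_
  rw [← hv, hp.inner_left_eq_inner_right]

/-- With `s² = |f|` and `f = u |f|`, the factors are `u s` and `s`; the diagonal sum of `|f|` is `∑
‖s e‖²`. -/
theorem isTraceClass_iff {f : H →L[𝕜] H} : IsTraceClass b f ↔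
    ∃ g h : H →L[𝕜] H, IsHilbertSchmidt b g ∧ IsHilbertSchmidt b h ∧ f = g * h := by
  constructor
  · rintro ⟨p, hp, hpf, hs⟩
    obtain ⟨s, hsp, rfl⟩ := hp.exists_sqrt
    obtain ⟨u, hu⟩ := exists_eq_mul_of_norm_apply_le fun x =>
      (norm_apply_eq_of_mul_self_eq hp hpf x).le
    have hs' : IsHilbertSchmidt b s := by
      rw [isHilbertSchmidt_iff]
      refine hs.congr fun i => ?_
      rw [← inner_self_eq_norm_sq (𝕜 := 𝕜), ← hsp.inner_left_eq_inner_right]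
      rfl
    exact ⟨u * s, s, hs'.mul_left u, hs', by rw [hu, mul_assoc]⟩
  · rintro ⟨g, h, hg, hh, rfl⟩
    refine isTraceClass_of_summable_inner fun v => ?_
    rw [← mul_assoc]
    exact (hg.mul_left v).summable_inner hh

namespace IsTraceClass

variable {f g : H →L[𝕜] H}

theorem isHilbertSchmidt (hf : IsTraceClass b f) : IsHilbertSchmidt b f := by
  obtain ⟨g, h, -, hh, rfl⟩ := isTraceClass_iff.1 hf
  exact hh.mul_left g

theorem summable_inner (hf : IsTraceClass b f) :
    Summable fun i => inner 𝕜 (b i) (f (b i)) := by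
  obtain ⟨g, h, hg, hh, rfl⟩ := isTraceClass_iff.1 hf
  exact hg.summable_inner hh

theorem mul_left (hf : IsTraceClass b f) (u : H →L[𝕜] H) : IsTraceClass b (u * f) := by
  obtain ⟨g, h, hg, hh, rfl⟩ := isTraceClass_iff.1 hf
  exact isTraceClass_iff.2 ⟨u * g, h, hg.mul_left u, hh, (mul_assoc _ _ _).symm⟩

theorem star (hf : IsTraceClass b f) : IsTraceClass b (star f) := by
  obtain ⟨g, h, hg, hh, rfl⟩ := isTraceClass_iff.1 hf
  exact isTraceClass_iff.2 ⟨_, _, hh.star, hg.star, star_mul _ _⟩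

theorem add (hf : IsTraceClass b f) (hg : IsTraceClass b g) : IsTraceClass b (f + g) := by
  refine isTraceClass_of_summable_inner fun v => ?_
  refine ((hf.mul_left v).summable_inner.add (hg.mul_left v).summable_inner).congr fun i => ?_
  rw [mul_add, add_apply, inner_add_right]

theorem zero : IsTraceClass b (0 : H →L[𝕜] H) :=
  isTraceClass_iff.2 ⟨0, 0, .zero, .zero, (mul_zero _).symm⟩

theorem smul (c : 𝕜) (hf : IsTraceClass b f) : IsTraceClass b (c • f) := by
  simpa using hf.mul_left (c • 1)

theorem mul (_hf : IsTraceClass b f) (hg : IsTraceClass b g) : IsTraceClass b (f * g) :=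
  hg.mul_left f

theorem trace_mul_comm (hf : IsTraceClass b f) (hg : IsTraceClass b g) :
    trace b (f * g) = trace b (g * f) :=
  hf.isHilbertSchmidt.trace_mul_comm hg.isHilbertSchmidt

theorem trace_add (hf : IsTraceClass b f) (hg : IsTraceClass b g) :
    trace b (f + g) = trace b f + trace b g := by
  rw [trace, trace, trace, ← hf.summable_inner.tsum_add hg.summable_inner]
  exact tsum_congr fun i => by rw [add_apply, inner_add_right]

theorem rankOne (x y : H) : IsTraceClass b (rankOne 𝕜 x y) := by
  rcases eq_or_ne y 0 with rfl | hy
  · simpa using IsTraceClass.zero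
  -- This product of Hilbert–Schmidt operators is a nonzero multiple of the given one.
  have h : IsTraceClass b (InnerProductSpace.rankOne 𝕜 x y * InnerProductSpace.rankOne 𝕜 y y) :=
    isTraceClass_iff.2 ⟨_, _, .rankOne x y, .rankOne y y, rfl⟩
  have h' : InnerProductSpace.rankOne 𝕜 x y * InnerProductSpace.rankOne 𝕜 y y =
      (inner 𝕜 y y : 𝕜) • InnerProductSpace.rankOne 𝕜 x y := rankOne_comp_rankOne _ _ _ _
  rw [h'] at h
  have := h.smul (inner 𝕜 y y)⁻¹
  rwa [smul_smul, inv_mul_cancel₀ (inner_self_ne_zero.2 hy), one_smul] at this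

end IsTraceClass

omit [CompleteSpace H] in
theorem trace_smul (c : 𝕜) (f : H →L[𝕜] H) : trace b (c • f) = c * trace b f := by
  rw [trace, trace, ← tsum_mul_left]
  exact tsum_congr fun i => by rw [smul_apply, inner_smul_right]

omit [CompleteSpace H] in
theorem trace_zero : trace b (0 : H →L[𝕜] H) = 0 := by
  simp [trace]

omit [CompleteSpace H] in
theorem trace_rankOne (x y : H) : trace b (rankOne 𝕜 x y) = inner 𝕜 y x := by
  rw [trace, ← b.tsum_inner_mul_inner]
  exact tsum_congr fun i => by rw [rankOne_apply, inner_smul_right]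

theorem trace_rankOne_mul (x y : H) (f : H →L[𝕜] H) :
    trace b (rankOne 𝕜 x y * f) = inner 𝕜 y (f x) := by
  have : rankOne 𝕜 x y * f = rankOne 𝕜 x (adjoint f y) := rankOne_comp _ _ _
  rw [this, trace_rankOne, adjoint_inner_left]

variable (b) in
/-- The trace class operators, as a non-unital star subalgebra of the bounded operators. -/
def traceClassSubalgebra : NonUnitalStarSubalgebra 𝕜 (H →L[𝕜] H) where
  carrier := {f | IsTraceClass b f}
  add_mem' := IsTraceClass.add
  zero_mem' := IsTraceClass.zero
  mul_mem' := IsTraceClass.mul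
  smul_mem' c _ hf := hf.smul c
  star_mem' := IsTraceClass.star

end TraceClass

/-! ### Orthogonality and the Girard quantale of closed subspaces -/

namespace TraceClass

variable {𝕜 : Type*} [RCLike 𝕜] {H : Type*} [NormedAddCommGroup H] [InnerProductSpace 𝕜 H]
  [CompleteSpace H] {ι : Type*} {b : HilbertBasis ι 𝕜 H}

section Orth

variable {X Y : Set (H →L[𝕜] H)}

theorem orth_anti (h : X ⊆ Y) : orth b Y ⊆ orth b X := fun _ hg =>
  ⟨hg.1, fun f hf => hg.2 f (h hf)⟩

theorem subset_orth_orth (hX : ∀ f ∈ X, IsTraceClass b f) : X ⊆ orth b (orth b X) :=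
  fun f hf => ⟨hX f hf, fun g hg => by rw [hg.1.trace_mul_comm (hX f hf), hg.2 f hf]⟩

theorem orth_orth_orth (hX : ∀ f ∈ X, IsTraceClass b f) :
    orth b (orth b (orth b X)) = orth b X :=
  (orth_anti (subset_orth_orth hX)).antisymm (subset_orth_orth fun _ hf => hf.1)

theorem trace_mul_eq_zero_of_mem_orth_orth {g : H →L[𝕜] H} (hg : IsTraceClass b g)
    (h : ∀ f ∈ X, trace b (f * g) = 0) {f : H →L[𝕜] H} (hf : f ∈ orth b (orth b X)) :
    trace b (f * g) = 0 := by
  rw [hf.1.trace_mul_comm hg]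
  exact hf.2 g ⟨hg, h⟩

variable (b X) in
/-- The orthogonal of a set of operators is a linear subspace. -/
def orthSubmodule : Submodule 𝕜 (H →L[𝕜] H) where
  carrier := orth b X
  add_mem' hf hg := ⟨hf.1.add hg.1, fun k hk => by
    rw [mul_add, (hf.1.mul_left k).trace_add (hg.1.mul_left k), hf.2 k hk, hg.2 k hk, add_zero]⟩
  zero_mem' := ⟨.zero, fun k _ => by rw [mul_zero, trace_zero]⟩
  smul_mem' c f hf := ⟨hf.1.smul c, fun k hk => by
    rw [mul_smul_comm, trace_smul, hf.2 k hk, mul_zero]⟩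

end Orth

namespace ClosedSubspace

theorem carrier_injective :
    Function.Injective (carrier : ClosedSubspace b → Set (H →L[𝕜] H)) := by
  rintro ⟨X, _, _⟩ ⟨Y, _, _⟩ rfl
  rfl

scoped instance instPartialOrder : PartialOrder (ClosedSubspace b) :=
  letI : LE (ClosedSubspace b) := ⟨fun X Y => X.carrier ⊆ Y.carrier⟩
  letI : LT (ClosedSubspace b) := ⟨fun X Y => X.carrier ⊂ Y.carrier⟩
  carrier_injective.partialOrder _ Iff.rfl Iff.rfl

variable (b) in
/-- The closed subspace generated by a set of trace class operators. -/
def closure (S : Set (H →L[𝕜] H)) (hS : ∀ f ∈ S, IsTraceClass b f) : ClosedSubspace b where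
  carrier := orth b (orth b S)
  isTraceClass _ hf := hf.1
  orth_orth := by rw [orth_orth_orth hS]

theorem closure_le {S : Set (H →L[𝕜] H)} (hS : ∀ f ∈ S, IsTraceClass b f)
    {X : ClosedSubspace b} : closure b S hS ≤ X ↔ S ⊆ X.carrier :=
  ⟨fun h => (subset_orth_orth hS).trans h,
    fun h => (orth_anti (orth_anti h)).trans X.orth_orth.le⟩

/-- The negation `X ↦ Xᗮ` of closed subspaces. -/
def neg (X : ClosedSubspace b) : ClosedSubspace b where
  carrier := orth b X.carrier
  isTraceClass _ hf := hf.1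
  orth_orth := by rw [X.orth_orth]

theorem neg_neg (X : ClosedSubspace b) : X.neg.neg = X :=
  carrier_injective X.orth_orth

theorem neg_antitone : Antitone (neg : ClosedSubspace b → ClosedSubspace b) :=
  fun _ _ h => orth_anti h

scoped instance instSupSet : SupSet (ClosedSubspace b) where
  sSup s := closure b (⋃ X ∈ s, X.carrier) fun f hf => by
    obtain ⟨X, _, hf⟩ := Set.mem_iUnion₂.1 hf
    exact X.isTraceClass f hf

theorem isLUB_sSup (s : Set (ClosedSubspace b)) : IsLUB s (sSup s) :=
  isLUB_iff_le_iff.2 fun _ => (closure_le _).trans Set.iUnion₂_subset_iff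

scoped instance instCompleteLattice : CompleteLattice (ClosedSubspace b) := completeLatticeOfSup _ isLUB_sSup

scoped instance instMul : Mul (ClosedSubspace b) where
  mul X Y := closure b (X.carrier * Y.carrier) fun f hf => by
    obtain ⟨x, hx, y, hy, rfl⟩ := Set.mem_mul.1 hf
    exact (X.isTraceClass x hx).mul (Y.isTraceClass y hy)

theorem carrier_mul (X Y : ClosedSubspace b) :
    (X * Y).carrier = orth b (orth b (X.carrier * Y.carrier)) := rfl

theorem mul_mem_mul {X Y : ClosedSubspace b} {x y : H →L[𝕜] H} (hx : x ∈ X.carrier)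
    (hy : y ∈ Y.carrier) : x * y ∈ (X * Y).carrier :=
  (closure_le _).1 le_rfl (Set.mul_mem_mul hx hy)

theorem trace_mul_rotate {X Y Z : ClosedSubspace b} :
    (∀ x ∈ X.carrier, ∀ y ∈ Y.carrier, ∀ z ∈ Z.carrier, trace b (x * y * z) = 0) ↔
      ∀ y ∈ Y.carrier, ∀ z ∈ Z.carrier, ∀ x ∈ X.carrier, trace b (y * z * x) = 0 := by
  have h : ∀ x ∈ X.carrier, ∀ y ∈ Y.carrier, ∀ z ∈ Z.carrier,
      trace b (x * y * z) = trace b (y * z * x) := fun x hx y hy z hz => by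
    rw [mul_assoc, (X.isTraceClass x hx).trace_mul_comm
      ((Y.isTraceClass y hy).mul (Z.isTraceClass z hz))]
  exact ⟨fun H y hy z hz x hx => h x hx y hy z hz ▸ H x hx y hy z hz,
    fun H x hx y hy z hz => (h x hx y hy z hz).trans (H y hy z hz x hx)⟩

theorem mul_le_neg_iff {X Y Z : ClosedSubspace b} : X * Y ≤ Z.neg ↔
    ∀ x ∈ X.carrier, ∀ y ∈ Y.carrier, ∀ z ∈ Z.carrier, trace b (x * y * z) = 0 := by
  refine (closure_le _).trans ⟨fun h x hx y hy z hz => ?_, fun h => ?_⟩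
  · obtain ⟨h1, h2⟩ := h (Set.mul_mem_mul hx hy)
    rw [h1.trace_mul_comm (Z.isTraceClass z hz), h2 z hz]
  · rw [Set.mul_subset_iff]
    intro x hx y hy
    have hxy := (X.isTraceClass x hx).mul (Y.isTraceClass y hy)
    refine ⟨hxy, fun z hz => ?_⟩
    rw [(Z.isTraceClass z hz).trace_mul_comm hxy, h x hx y hy z hz]

theorem mul_le_neg_rotate {X Y Z : ClosedSubspace b} : X * Y ≤ Z.neg ↔ Y * Z ≤ X.neg := by
  rw [mul_le_neg_iff, trace_mul_rotate, mul_le_neg_iff]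

theorem le_neg_comm {X Y : ClosedSubspace b} : X ≤ Y.neg ↔ Y ≤ X.neg :=
  ⟨fun h => Y.neg_neg.ge.trans (neg_antitone h), fun h => X.neg_neg.ge.trans (neg_antitone h)⟩

/-- Multiplication by `X` has an explicit right adjoint, so it preserves suprema. -/
theorem mul_le_iff_le_right {X Y Z : ClosedSubspace b} :
    X * Y ≤ Z ↔ Y ≤ (Z.neg * X).neg := by
  rw [le_neg_comm, mul_le_neg_rotate, neg_neg]

theorem mul_le_iff_le_left {X Y Z : ClosedSubspace b} :
    X * Y ≤ Z ↔ X ≤ (Y * Z.neg).neg := by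
  rw [le_neg_comm, mul_le_neg_rotate, mul_le_neg_rotate, neg_neg]

/-- Vanishing of the trace against a fixed operator passes to biorthogonals, so the closure taken in
`X * Y` can be ignored. -/
theorem mul_mul_le_neg_iff {X Y Z W : ClosedSubspace b} : X * Y * Z ≤ W.neg ↔
    ∀ x ∈ X.carrier, ∀ y ∈ Y.carrier, ∀ z ∈ Z.carrier, ∀ w ∈ W.carrier,
      trace b (x * y * (z * w)) = 0 := by
  rw [mul_le_neg_iff]
  constructor
  · intro h x hx y hy z hz w hw
    rw [← mul_assoc]
    exact h _ (mul_mem_mul hx hy) z hz w hw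
  · intro h v hv z hz w hw
    rw [mul_assoc]
    refine trace_mul_eq_zero_of_mem_orth_orth
      ((Z.isTraceClass z hz).mul (W.isTraceClass w hw)) ?_ hv
    intro f hf
    obtain ⟨x, hx, y, hy, rfl⟩ := Set.mem_mul.1 hf
    exact h x hx y hy z hz w hw

protected theorem mul_assoc (X Y Z : ClosedSubspace b) : X * Y * Z = X * (Y * Z) := by
  refine eq_of_forall_ge_iff fun W => ?_
  -- Rotation turns `X * (Y * Z) ≤ Wᗮᗮ` into `Y * Z * Wᗮ ≤ Xᗮ`, so both sides become conditions on
  -- fourfold traces, equal by cyclicity.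
  rw [← W.neg_neg, mul_le_neg_rotate (X := X), mul_mul_le_neg_iff, mul_mul_le_neg_iff]
  have h : ∀ x ∈ X.carrier, ∀ y ∈ Y.carrier, ∀ z ∈ Z.carrier, ∀ w ∈ W.neg.carrier,
      trace b (x * y * (z * w)) = trace b (y * z * (w * x)) := fun x hx y hy z hz w hw => by
    rw [mul_assoc, (X.isTraceClass x hx).trace_mul_comm
      ((Y.isTraceClass y hy).mul ((Z.isTraceClass z hz).mul (W.neg.isTraceClass w hw)))]
    simp only [mul_assoc]
  exact ⟨fun H y hy z hz w hw x hx => (h x hx y hy z hz w hw).symm.trans (H x hx y hy z hz w hw),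
    fun H x hx y hy z hz w hw => (h x hx y hy z hz w hw).trans (H y hy z hz w hw x hx)⟩

scoped instance instSemigroup : Semigroup (ClosedSubspace b) where
  mul_assoc := ClosedSubspace.mul_assoc

scoped instance instIsQuantale : IsQuantale (ClosedSubspace b) where
  mul_sSup_distrib X s := eq_of_forall_ge_iff fun Z => by
    simp only [mul_le_iff_le_right, sSup_le_iff, iSup_le_iff]
  sSup_mul_distrib s X := eq_of_forall_ge_iff fun Z => by
    simp only [mul_le_iff_le_left, sSup_le_iff, iSup_le_iff]

theorem isGirardQuantale_neg : IsGirardQuantale (neg : ClosedSubspace b → ClosedSubspace b) where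
  antitone_lneg := neg_antitone
  antitone_rneg := neg_antitone
  leftInverse := neg_neg
  rightInverse := neg_neg
  contraposition X Y := eq_of_forall_le_iff fun Z => by
    rw [Quantale.rightMulResiduation_le_iff_mul_le, Quantale.leftMulResiduation_le_iff_mul_le,
      mul_le_neg_rotate]

theorem exists_submodule_eq_carrier (X : ClosedSubspace b) :
    ∃ V : Submodule 𝕜 (H →L[𝕜] H), (V : Set (H →L[𝕜] H)) = X.carrier :=
  ⟨orthSubmodule b (orth b X.carrier), X.orth_orth⟩

end ClosedSubspace

end TraceClass

/-! ### Absence of units -/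

namespace TraceClass

variable {𝕜 : Type*} [RCLike 𝕜] {H : Type*} [NormedAddCommGroup H] [InnerProductSpace 𝕜 H]
  [CompleteSpace H] {ι : Type*} {b : HilbertBasis ι 𝕜 H}

open InnerProductSpace

omit [CompleteSpace H] in
theorem infinite_of_not_finiteDimensional (hH : ¬ FiniteDimensional 𝕜 H)
    (b : HilbertBasis ι 𝕜 H) : Infinite ι := by
  by_contra h
  have : Finite ι := not_infinite_iff_finite.1 h
  have : Fintype ι := Fintype.ofFinite ι
  exact hH b.toOrthonormalBasis.toBasis.finiteDimensional_of_finite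

theorem eq_zero_of_isTraceClass_smul_one [Infinite ι] {c : 𝕜}
    (h : IsTraceClass b (c • (1 : H →L[𝕜] H))) : c = 0 := by
  have h1 := isHilbertSchmidt_iff.1 h.isHilbertSchmidt
  have h2 : Summable fun _ : ι => ‖c‖ ^ 2 := h1.congr fun i => by
    rw [smul_apply, norm_smul, one_apply_eq_self,
      b.orthonormal.1 i, mul_one]
  simpa using (summable_const_iff _).1 h2

omit [CompleteSpace H] in
theorem mul_rankOne (u : H →L[𝕜] H) (x y : H) : u * rankOne 𝕜 x y = rankOne 𝕜 (u x) y :=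
  comp_rankOne _ _ _

theorem not_exists_unit [Infinite ι] : ¬ ∃ u : H →L[𝕜] H, IsTraceClass b u ∧
    ∀ f : H →L[𝕜] H, IsTraceClass b f → u * f = f ∧ f * u = f := by
  rintro ⟨u, hu, h⟩
  have h1 : u = (1 : 𝕜) • 1 := by
    ext x
    have h2 := congrArg (fun f : H →L[𝕜] H => f x) (h _ (.rankOne x x)).1
    rcases eq_or_ne x 0 with rfl | hx
    · simp
    simp only [mul_rankOne, rankOne_apply] at h2
    simpa using smul_right_injective H (inner_self_ne_zero.2 hx) h2
  rw [h1] at hu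
  exact one_ne_zero (eq_zero_of_isTraceClass_smul_one hu)

variable (b) in
/-- The closed subspace generated by the rank one operator `y ↦ ⟪x, y⟫ x`. -/
noncomputable def rankOneClosure (x : H) : ClosedSubspace b :=
  ClosedSubspace.closure b {rankOne 𝕜 x x} fun f hf => by
    rw [Set.mem_singleton_iff.1 hf]
    exact .rankOne x x

open scoped ClosedSubspace in
theorem rankOne_mem_rankOneClosure (x : H) : rankOne 𝕜 x x ∈ (rankOneClosure b x).carrier :=
  (ClosedSubspace.closure_le _).1 le_rfl rfl

/-- For `z ⊥ x`, the operator `rankOne 𝕜 x z` is orthogonal to the generator. Pairing it with `u *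
rankOne 𝕜 x x` gives `⟪x, x⟫ ⟪z, u x⟫ = 0`, so `u x ∈ {x}ᗮᗮ`. -/
theorem apply_mem_span_of_mul_rankOne_mem {u : H →L[𝕜] H} {x : H}
    (h : u * rankOne 𝕜 x x ∈ (rankOneClosure b x).carrier) : u x ∈ Submodule.span 𝕜 {x} := by
  rcases eq_or_ne x 0 with rfl | hx
  · simp
  rw [← Submodule.orthogonal_orthogonal (Submodule.span 𝕜 {x}), Submodule.mem_orthogonal]
  intro z hz
  rw [Submodule.mem_orthogonal_singleton_iff_inner_left] at hz
  have h1 : rankOne 𝕜 x z ∈ orth b {rankOne 𝕜 x x} := by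
    refine ⟨.rankOne x z, fun f hf => ?_⟩
    rw [Set.mem_singleton_iff.1 hf, trace_rankOne_mul, rankOne_apply, hz, zero_smul,
      inner_zero_right]
  have h2 := h.2 _ h1
  rw [mul_rankOne, trace_rankOne_mul, rankOne_apply, inner_smul_right] at h2
  exact (mul_eq_zero.1 h2).resolve_left (inner_self_ne_zero.2 hx)

omit [CompleteSpace H] in
theorem exists_eq_smul_one_of_forall_mem_span {u : H →L[𝕜] H}
    (h : ∀ x, u x ∈ Submodule.span 𝕜 {x}) : ∃ c : 𝕜, u = c • 1 := by
  obtain ⟨c, hc⟩ := (u : H →ₗ[𝕜] H).exists_eq_smul_id_of_forall_notLinearIndependent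
    fun x hx => by
      obtain ⟨c, hc⟩ := Submodule.mem_span_singleton.1 (h x)
      have := LinearIndependent.pair_iff.1 hx c (-1) (by simp [hc])
      simp at this
  exact ⟨c, ContinuousLinearMap.ext fun x => congrArg (fun f : H →ₗ[𝕜] H => f x) hc⟩

open scoped ClosedSubspace in
theorem not_exists_closedSubspace_unit [Infinite ι] :
    ¬ ∃ U : ClosedSubspace b, ∀ X, U * X = X ∧ X * U = X := by
  rintro ⟨U, hU⟩
  have h0 : ∀ u ∈ U.carrier, u = 0 := fun u hu => by
    obtain ⟨c, rfl⟩ := exists_eq_smul_one_of_forall_mem_span fun x =>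
      apply_mem_span_of_mul_rankOne_mem (b := b) <| by
        have := ClosedSubspace.mul_mem_mul hu (rankOne_mem_rankOneClosure (b := b) x)
        rwa [(hU _).1] at this
    rw [eq_zero_of_isTraceClass_smul_one (U.isTraceClass _ hu), zero_smul]
  obtain ⟨i⟩ := (inferInstance : Nonempty ι)
  have h1 := rankOne_mem_rankOneClosure (b := b) (b i)
  rw [← (hU (rankOneClosure b (b i))).1, ClosedSubspace.carrier_mul] at h1
  -- All these products are `0`, so the projection onto `b i` would be orthogonal to itself,
  -- although its square has trace `1`.
  have h2 : rankOne 𝕜 (b i) (b i) ∈ orth b (U.carrier * (rankOneClosure b (b i)).carrier) := by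
    refine ⟨.rankOne _ _, fun f hf => ?_⟩
    obtain ⟨u, hu, x, -, rfl⟩ := Set.mem_mul.1 hf
    rw [h0 u hu, zero_mul, zero_mul, trace_zero]
  have h3 := h1.2 _ h2
  rw [trace_rankOne_mul, rankOne_apply, inner_smul_right,
    inner_self_eq_norm_sq_to_K, b.orthonormal.1 i] at h3
  simp at h3

end TraceClass

theorem mainTheorem6 {𝕜 : Type*} [RCLike 𝕜] {H : Type*} [NormedAddCommGroup H]
    [InnerProductSpace 𝕜 H] [CompleteSpace H] (hH : ¬ FiniteDimensional 𝕜 H)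
    {ι : Type*} (b : HilbertBasis ι 𝕜 H) :
    -- the trace class operators form a *-algebra without unit, on which the trace converges
    (∃ A : NonUnitalStarSubalgebra 𝕜 (H →L[𝕜] H), ∀ f, f ∈ A ↔ TraceClass.IsTraceClass b f) ∧
    (∀ f : H →L[𝕜] H, TraceClass.IsTraceClass b f →
      Summable fun i => inner 𝕜 (b i) (f (b i))) ∧
    (¬ ∃ u : H →L[𝕜] H, TraceClass.IsTraceClass b u ∧
      ∀ f : H →L[𝕜] H, TraceClass.IsTraceClass b f → u * f = f ∧ f * u = f) ∧
    -- the closed sets are linear subspaces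
    (∀ X : TraceClass.ClosedSubspace b,
      ∃ V : Submodule 𝕜 (H →L[𝕜] H), (V : Set (H →L[𝕜] H)) = X.carrier) ∧
    -- they form a Girard quantale without unit
    ∃ (_ : CompleteLattice (TraceClass.ClosedSubspace b))
      (_ : Semigroup (TraceClass.ClosedSubspace b))
      (_ : IsQuantale (TraceClass.ClosedSubspace b))
      (neg : TraceClass.ClosedSubspace b → TraceClass.ClosedSubspace b),
      (∀ X Y : TraceClass.ClosedSubspace b, X ≤ Y ↔ X.carrier ⊆ Y.carrier) ∧
      (∀ X Y : TraceClass.ClosedSubspace b,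
        (X * Y).carrier = TraceClass.orth b (TraceClass.orth b (X.carrier * Y.carrier))) ∧
      (∀ X : TraceClass.ClosedSubspace b, (neg X).carrier = TraceClass.orth b X.carrier) ∧
      IsGirardQuantale neg ∧
      ¬ ∃ u : TraceClass.ClosedSubspace b, ∀ X, u * X = X ∧ X * u = X := by
  have := TraceClass.infinite_of_not_finiteDimensional hH b
  exact ⟨⟨TraceClass.traceClassSubalgebra b, fun _ => Iff.rfl⟩, fun _ hf => hf.summable_inner,
    TraceClass.not_exists_unit, TraceClass.ClosedSubspace.exists_submodule_eq_carrier,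
    TraceClass.ClosedSubspace.instCompleteLattice, TraceClass.ClosedSubspace.instSemigroup,
    TraceClass.ClosedSubspace.instIsQuantale, TraceClass.ClosedSubspace.neg,
    fun _ _ => Iff.rfl, fun _ _ => rfl, fun _ => rfl,
    TraceClass.ClosedSubspace.isGirardQuantale_neg, TraceClass.not_exists_closedSubspace_unit⟩
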